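/- For a group $\Gamma$ with finite generating set $S$, let $d_S$ be the path metric of the Cayley graph $\mathrm{Cay}(\Gamma,S)$, in which distinct $x,y$ are adjacent when $x^{-1}y\in S\cup S^{-1}$. $\Gamma$ has polynomial growth if $|B_{d_S}(1,r)|=O(r^{d})$ for some $d$, and its growth degree is the infimum of the real numbers $d$ with this property (this does not depend on $S$). The wreath product is $N\wr G=N^{(G)}\rtimes G$, where $N^{(G)}$ is the group of finitely supported maps $c\colon G\to N$ under pointwise multiplication and $(g\cdot c)(x)=c(g^{-1}x)$; its elements are pairs $(c,p)$. A map $f\colon X\to Y$ between metric spaces is a quasi-isometry if there are $C\ge 1$, $K\ge 0$ with $\frac1C d(x,y)-K\le d(f(x),f(y))\le C\,d(x,y)+K$ for all $x,y\in X$ and every point of $Y$ is at distance at most $K$ from some point of $f(X)$; a quasi-inverse of $f$ is a map $g\colon Y\to X$ such that $g\circ f$ and $f\circ g$ are within bounded distance of the identity maps. A quasi-isometry $q\colon N\wr G\to M\wr H$ is aptolic if it has the form $(c,p)\mapsto(\alpha(c),\beta(p))$ for some maps $\alpha\colon N^{(G)}\to M^{(H)}$, $\beta\colon G\to H$, and has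 a quasi-inverse $M\wr H\to N\wr G$ of the analogous form. For $k>0$, a quasi-isometry $f\colon X\to Y$ between connected bounded degree graphs is quasi-$k$-to-one if there is a constant $C>0$ such that $\bigl|k|A|-|f^{-1}(A)|\bigr|\le C\,|\partial A|$ for every finite set $A$ of vertices of $Y$, where $\partial A$ is the set of vertices outside $A$ that are adjacent to a vertex of $A$. **Theorem A.** Let $N$ and $M$ be finitely generated groups of polynomial growth, with growth degrees $n$ and $m$, where $n>0$ (that is, $N$ is infinite). Let $G$ and $H$ be finitely generated amenable groups, with $G$ infinite. Equip $N\wr G$ and $M\wr H$ with the Cayley graphs of arbitrary finite generating sets. Suppose that every quasi-isometry $N\wr G\to M\wr H$ is within bounded distance of an aptolic quasi-isometry. Then every quasi-isometry $N\wr G\to M\wr H$ is quasi-$\frac{m}{n}$-to-one (in particular, $m>0$ if such a quasi-isometry exists). -/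

import Mathlib

namespace Lamplighter

/-! ### Coarse geometry of graphs

The distances below are path distances of graphs; all graphs to which the definitions are applied
are Cayley graphs of finitely generated groups, hence connected and of bounded degree. -/

section Coarse

variable {V W : Type*}

/-- `f` is a quasi-isometry between (the vertex sets of) the graphs `X` and `Y`, for some constants
`C ≥ 1` and `K ≥ 0`. -/
def IsQuasiIsometry (X : SimpleGraph V) (Y : SimpleGraph W) (f : V → W) : Prop :=
  ∃ C K : ℝ, 1 ≤ C ∧ 0 ≤ K ∧
    (∀ x y : V, 1 / C * (X.dist x y : ℝ) - K ≤ (Y.dist (f x) (f y) : ℝ) ∧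
      (Y.dist (f x) (f y) : ℝ) ≤ C * (X.dist x y : ℝ) + K) ∧
    ∀ y : W, ∃ x : V, (Y.dist y (f x) : ℝ) ≤ K

/-- The maps `f` and `g` into the graph `Y` are within bounded distance from each other. -/
def AtBoundedDistance (Y : SimpleGraph W) (f g : V → W) : Prop :=
  ∃ K : ℝ, ∀ x : V, (Y.dist (f x) (g x) : ℝ) ≤ K

/-- `g` is a quasi-inverse of `f`: both compositions are within bounded distance from the
identity. -/
def IsQuasiInverse (X : SimpleGraph V) (Y : SimpleGraph W) (f : V → W) (g : W → V) : Prop :=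
  AtBoundedDistance X (g ∘ f) id ∧ AtBoundedDistance Y (f ∘ g) id

/-- The (outer vertex) boundary of a set `A` of vertices of the graph `Y`. -/
def boundary (Y : SimpleGraph W) (A : Set W) : Set W :=
  {y | y ∉ A ∧ ∃ x ∈ A, Y.Adj x y}

/-- `f` is a quasi-`k`-to-one quasi-isometry, where `k > 0`. -/
def IsQuasiToOne (X : SimpleGraph V) (Y : SimpleGraph W) (k : ℝ) (f : V → W) : Prop :=
  IsQuasiIsometry X Y f ∧ 0 < k ∧
    ∃ C : ℝ, 0 < C ∧ ∀ A : Set W, A.Finite →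
      |k * (A.ncard : ℝ) - ((f ⁻¹' A).ncard : ℝ)| ≤ C * ((boundary Y A).ncard : ℝ)

end Coarse

/-! ### Finitely generated groups -/

section Groups

/-- `S` is a finite generating set of the group `Γ`. -/
def IsFiniteGeneratingSet {Γ : Type*} [Group Γ] (S : Set Γ) : Prop :=
  S.Finite ∧ Subgroup.closure S = ⊤

/-- The growth function of a group with respect to `S`: the number of elements in the closed ball
of radius `r` around the identity of the Cayley graph. -/
noncomputable def growth {Γ : Type*} [Group Γ] (S : Set Γ) (r : ℕ) : ℕ :=
  {x : Γ | (SimpleGraph.mulCayley S).dist 1 x ≤ r}.ncard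

/-- The real exponents `d` such that the growth function is bounded by a multiple of `r ^ d`. -/
def growthExponents {Γ : Type*} [Group Γ] (S : Set Γ) : Set ℝ :=
  {d | ∃ C : ℝ, ∀ r : ℕ, 1 ≤ r → (growth S r : ℝ) ≤ C * (r : ℝ) ^ d}

/-- The finitely generated group `Γ` has polynomial growth, of degree `n`: there is some exponent
`d` for which the growth function is `O(r ^ d)`, and `n` is the infimum of these exponents. (This
does not depend on the finite generating set.) -/
def HasPolynomialGrowthOfDegree (Γ : Type*) [Group Γ] (n : ℝ) : Prop :=
  ∃ S : Set Γ, IsFiniteGeneratingSet S ∧ (growthExponents S).Nonempty ∧ IsGLB (growthExponents S) n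

/-- Amenability of a discrete group, through Følner's condition. -/
def IsAmenableGroup (Γ : Type*) [Group Γ] : Prop :=
  ∀ S : Set Γ, S.Finite → ∀ ε : ℝ, 0 < ε → ∃ F : Set Γ, F.Finite ∧ F.Nonempty ∧
    ∀ g ∈ S, ((((fun x => g * x) '' F) \ F).ncard : ℝ) ≤ ε * (F.ncard : ℝ)

end Groups

/-! ### Wreath products -/

section WreathProducts

variable (N G : Type*) [Group N] [Group G]

/-- The direct sum of copies of `N` indexed by `G`: the group, under pointwise multiplication, of
all finitely supported maps (colourings) from `G` to `N`. -/
def colourings : Subgroup (G → N) where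
  carrier := {c | (Function.mulSupport c).Finite}
  one_mem' := by simp
  mul_mem' := fun {a b} ha hb => (ha.union hb).subset (Function.mulSupport_mul a b)
  inv_mem' := fun {a} ha => by simpa [Function.mulSupport_inv] using ha

/-- The action of `G` on colourings by translation of the coordinates:
`(g • c) x = c (g⁻¹ * x)`. -/
def shift : G →* MulAut (colourings N G) where
  toFun g :=
    { toFun := fun c => ⟨fun x => c.1 (g⁻¹ * x),
        Set.Finite.preimage (mul_right_injective g⁻¹).injOn c.2⟩
      invFun := fun c => ⟨fun x => c.1 (g * x),
        Set.Finite.preimage (mul_right_injective g).injOn c.2⟩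
      left_inv := fun c => by ext x; simp
      right_inv := fun c => by ext x; simp
      map_mul' := fun c d => by ext x; simp }
  map_one' := by ext c x; simp
  map_mul' := fun g h => by ext c x; simp [mul_assoc]

/-- The wreath product of `N` and `G`, the semidirect product of the direct sum of copies of `N`
indexed by `G` with `G`. An element is a pair `(c, p)` with `c = x.left` and `p = x.right`. -/
abbrev Wreath : Type _ := SemidirectProduct (colourings N G) G (shift N G)

end WreathProducts

/-! ### Aptolic quasi-isometries -/

section Aptolic

variable {N G M H : Type*} [Group N] [Group G] [Group M] [Group H]

/-- The map `f` has the form `(c, p) ↦ (α c, β p)`. -/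
def IsOfAptolicForm (f : Wreath N G → Wreath M H) : Prop :=
  ∃ (α : colourings N G → colourings M H) (β : G → H),
    ∀ (c : colourings N G) (p : G), f ⟨c, p⟩ = ⟨α c, β p⟩

/-- `f` is an aptolic quasi-isometry, for the word metrics given by `U` and `V`: it is a
quasi-isometry of aptolic form that has a quasi-inverse of aptolic form. -/
def IsAptolic (U : Set (Wreath N G)) (V : Set (Wreath M H)) (f : Wreath N G → Wreath M H) : Prop :=
  IsQuasiIsometry (SimpleGraph.mulCayley U) (SimpleGraph.mulCayley V) f ∧ IsOfAptolicForm f ∧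
    ∃ g : Wreath M H → Wreath N G,
      IsQuasiInverse (SimpleGraph.mulCayley U) (SimpleGraph.mulCayley V) f g ∧ IsOfAptolicForm g

end Aptolic

end Lamplighter

namespace Lamplighter

open scoped Pointwise

/-! ### Balls in Cayley graphs as powers of a finite set -/

section WordBalls

variable {Γ : Type*} [Group Γ]

/-! Replace the quasi-isometry by an aptolic one `(c, p) ↦ (α c, β p)` at bounded distance. Moving a
bounded distance from `(c, p)` alters `c` only near `p`, and `p` may be taken far from any given
lamp because `G` is infinite. The colouring parts of an aptolic map and its quasi-inverse are
therefore exact inverses, so `α` is injective (`eq_of_areClose_id`).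

Changing one lamp `p` within the `r`-ball of `N` changes `α c` only on `β p * B`, by elements of the
`L * r`-ball of `M`. For finite `F`, colourings of `F` by the `r`-ball thus inject into colourings
of `β(F) * B` by the ball of radius `L * r * |F|` (`growth_pow_le`). Comparing growth in `r` with
`F` fixed gives `n |F| ≤ m |β(F) * B|` (`exists_ncard_image_base`).

Counting over each colouring separately lifts this inequality to the wreath products
(`exists_ncard_image`). The quasi-inverse satisfies it with `n` and `m` exchanged. Applied to the
preimage of `A` and to `A` with a neighbourhood of its complement removed, the two inequalities
bound the size of the preimage from above and below, up to multiples of the boundary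
(`isQuasiToOne_of_ncard_le`). -/

lemma ncard_mul_le (s t : Set Γ) : (s * t).ncard ≤ s.ncard * t.ncard :=
  Set.natCard_mul_le

/-- The unit ball around the identity of the Cayley graph with respect to `S`; its powers are the
balls of larger radii. -/
def unitBall (S : Set Γ) : Set Γ := insert 1 (S ∪ S⁻¹)

lemma one_mem_unitBall (S : Set Γ) : (1 : Γ) ∈ unitBall S := Set.mem_insert _ _

lemma unitBall_finite {S : Set Γ} (hS : S.Finite) : (unitBall S).Finite :=
  (hS.union hS.inv).insert 1

lemma unitBall_pow_finite {S : Set Γ} (hS : S.Finite) (r : ℕ) : (unitBall S ^ r).Finite := by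
  induction r with
  | zero => simp
  | succ r ih => rw [pow_succ]; exact ih.mul (unitBall_finite hS)

lemma unitBall_pow_mono (S : Set Γ) {r s : ℕ} (h : r ≤ s) : unitBall S ^ r ⊆ unitBall S ^ s :=
  Set.pow_subset_pow_right (one_mem_unitBall S) h

lemma one_mem_unitBall_pow (S : Set Γ) (r : ℕ) : (1 : Γ) ∈ unitBall S ^ r :=
  unitBall_pow_mono S (Nat.zero_le r) (by simp)

lemma unitBall_inv (S : Set Γ) : (unitBall S)⁻¹ = unitBall S := by
  simp [unitBall, Set.inv_insert, Set.union_comm]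

lemma inv_mem_unitBall_pow {S : Set Γ} {r : ℕ} {x : Γ} (hx : x ∈ unitBall S ^ r) :
    x⁻¹ ∈ unitBall S ^ r := by
  rw [← Set.mem_inv, ← inv_pow, unitBall_inv]
  exact hx

lemma exists_mem_unitBall_pow {S : Set Γ} (hS : IsFiniteGeneratingSet S) (x : Γ) :
    ∃ r : ℕ, x ∈ unitBall S ^ r := by
  have hx : x ∈ Subgroup.closure S := hS.2 ▸ Subgroup.mem_top x
  induction hx using Subgroup.closure_induction with
  | mem x hx => exact ⟨1, by simp [unitBall, hx]⟩
  | one => exact ⟨0, by simp⟩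
  | mul x y _ _ hx hy =>
    obtain ⟨r, hr⟩ := hx
    obtain ⟨s, hs⟩ := hy
    exact ⟨r + s, by rw [pow_add]; exact Set.mul_mem_mul hr hs⟩
  | inv x _ hx => exact hx.imp fun r hr => inv_mem_unitBall_pow hr

lemma exists_subset_unitBall_pow {S : Set Γ} (hS : IsFiniteGeneratingSet S) {E : Set Γ}
    (hE : E.Finite) : ∃ r : ℕ, E ⊆ unitBall S ^ r := by
  induction E, hE using Set.Finite.induction_on with
  | empty => exact ⟨0, Set.empty_subset _⟩
  | insert _ _ ih =>
    obtain ⟨r, hr⟩ := ih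
    obtain ⟨s, hs⟩ := exists_mem_unitBall_pow hS _
    exact ⟨max r s, Set.insert_subset (unitBall_pow_mono S (le_max_right _ _) hs)
      (hr.trans (unitBall_pow_mono S (le_max_left _ _)))⟩

lemma inv_mul_mem_unitBall_of_adj {S : Set Γ} {x y : Γ} (h : (SimpleGraph.mulCayley S).Adj x y) :
    x⁻¹ * y ∈ unitBall S := by
  rw [SimpleGraph.mulCayley_adj] at h
  rcases h.2 with h | h
  · exact Or.inr (Or.inl h)
  · exact Or.inr (Or.inr (by simpa using h))

lemma eq_or_adj_of_mem_unitBall {S : Set Γ} {t : Γ} (ht : t ∈ unitBall S) (x : Γ) :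
    x = x * t ∨ (SimpleGraph.mulCayley S).Adj x (x * t) := by
  by_cases h : x = x * t
  · exact Or.inl h
  · refine Or.inr ((SimpleGraph.mulCayley_adj _ _ _).2 ⟨h, ?_⟩)
    rcases ht with rfl | ht | ht
    · simp at h
    · exact Or.inl (by simpa using ht)
    · exact Or.inr (by simpa using ht)

lemma exists_walk_of_mem_unitBall_pow {S : Set Γ} {r : ℕ} {x y : Γ}
    (h : x⁻¹ * y ∈ unitBall S ^ r) :
    ∃ p : (SimpleGraph.mulCayley S).Walk x y, p.length ≤ r := by
  induction r generalizing y with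
  | zero =>
    obtain rfl : x = y := by simpa [inv_mul_eq_one] using h
    exact ⟨.nil, le_rfl⟩
  | succ r ih =>
    rw [pow_succ] at h
    obtain ⟨a, ha, t, ht, hat⟩ := h
    obtain rfl : y = x * a * t := by simp only at hat; rw [mul_assoc, hat]; simp
    obtain ⟨p, hp⟩ := ih (y := x * a) (by simpa using ha)
    rcases eq_or_adj_of_mem_unitBall ht (x * a) with h | h
    · rw [← h]
      exact ⟨p, hp.trans (Nat.le_succ r)⟩
    · exact ⟨p.concat h, by simpa using hp⟩

lemma inv_mul_mem_unitBall_pow_of_walk {S : Set Γ} {x y : Γ}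
    (p : (SimpleGraph.mulCayley S).Walk x y) : x⁻¹ * y ∈ unitBall S ^ p.length := by
  induction p with
  | nil => simp
  | @cons u v w h p ih =>
    rw [SimpleGraph.Walk.length_cons, pow_succ']
    exact ⟨_, inv_mul_mem_unitBall_of_adj h, _, ih, by simp [mul_assoc]⟩

lemma dist_mulCayley_le_iff {S : Set Γ} (hS : IsFiniteGeneratingSet S) {x y : Γ} {r : ℕ} :
    (SimpleGraph.mulCayley S).dist x y ≤ r ↔ x⁻¹ * y ∈ unitBall S ^ r := by
  constructor
  · intro h
    -- Generation makes `x` and `y` connected, so the distance is attained by a walk and is not the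
    -- default value 0.
    obtain ⟨s, hs⟩ := exists_mem_unitBall_pow hS (x⁻¹ * y)
    obtain ⟨p, -⟩ := exists_walk_of_mem_unitBall_pow hs
    obtain ⟨p, hp⟩ := p.reachable.exists_walk_length_eq_dist
    exact unitBall_pow_mono S (hp.trans_le h) (inv_mul_mem_unitBall_pow_of_walk p)
  · intro h
    obtain ⟨p, hp⟩ := exists_walk_of_mem_unitBall_pow h
    exact (SimpleGraph.dist_le p).trans hp

lemma growth_eq_ncard {S : Set Γ} (hS : IsFiniteGeneratingSet S) (r : ℕ) :
    growth S r = (unitBall S ^ r).ncard := by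
  simp [growth, dist_mulCayley_le_iff hS]

lemma boundary_finite {S : Set Γ} (hS : S.Finite) {A : Set Γ} (hA : A.Finite) :
    (boundary (SimpleGraph.mulCayley S) A).Finite := by
  refine (hA.mul (unitBall_finite hS)).subset ?_
  rintro y ⟨-, x, hx, hxy⟩
  exact ⟨x, hx, _, inv_mul_mem_unitBall_of_adj hxy, by simp⟩

/-- A path leaving `A` meets the boundary at its first exit point, and the rest of the path is no
longer than the whole. -/
lemma exists_mem_boundary {S : Set Γ} {A : Set Γ} {r : ℕ} {x y : Γ} (hx : x ∈ A) (hy : y ∉ A)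
    (h : x⁻¹ * y ∈ unitBall S ^ r) :
    ∃ b ∈ boundary (SimpleGraph.mulCayley S) A, b⁻¹ * y ∈ unitBall S ^ r := by
  induction r generalizing x with
  | zero =>
    obtain rfl : x = y := by simpa [inv_mul_eq_one] using h
    exact absurd hx hy
  | succ r ih =>
    rw [pow_succ'] at h
    obtain ⟨t, ht, a, ha, hta⟩ := h
    obtain rfl : y = x * t * a := by simp only at hta; rw [mul_assoc, hta]; simp
    by_cases hxt : x * t ∈ A
    · obtain ⟨b, hb, hby⟩ := ih hxt (by simpa [mul_assoc] using ha)
      exact ⟨b, hb, unitBall_pow_mono S (Nat.le_succ r) hby⟩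
    · refine ⟨x * t, ⟨hxt, x, hx, ?_⟩, unitBall_pow_mono S (Nat.le_succ r) (by simpa [mul_assoc] using ha)⟩
      rcases eq_or_adj_of_mem_unitBall ht x with h | h
      · exact absurd (h ▸ hx) hxt
      · exact h

/-- The part of a bounded thickening of `A` outside `A` is controlled by the boundary of `A`. -/
lemma exists_ncard_mul_diff_le {S : Set Γ} (hS : IsFiniteGeneratingSet S) {E : Set Γ}
    (hE : E.Finite) :
    ∃ C : ℕ, ∀ A : Set Γ, A.Finite →
      ((A * E) \ A).ncard ≤ C * (boundary (SimpleGraph.mulCayley S) A).ncard := by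
  obtain ⟨r, hr⟩ := exists_subset_unitBall_pow hS hE
  refine ⟨(unitBall S ^ r).ncard, fun A hA => ?_⟩
  have hsub : (A * E) \ A ⊆ boundary (SimpleGraph.mulCayley S) A * unitBall S ^ r := by
    rintro y ⟨⟨x, hx, e, he, rfl⟩, hy⟩
    obtain ⟨b, hb, hby⟩ := exists_mem_boundary hx hy (r := r) (by simpa using hr he)
    exact ⟨b, hb, _, hby, by simp⟩
  calc ((A * E) \ A).ncard ≤ (boundary (SimpleGraph.mulCayley S) A * unitBall S ^ r).ncard :=
        Set.ncard_le_ncard hsub ((boundary_finite hS.1 hA).mul (unitBall_pow_finite hS.1 r))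
    _ ≤ (boundary (SimpleGraph.mulCayley S) A).ncard * (unitBall S ^ r).ncard := ncard_mul_le _ _
    _ = _ := mul_comm _ _

end WordBalls

/-! ### Coarse maps between groups, and the counting criterion -/

section Controlled

variable {X Γ Λ : Type*} [Group Γ] [Group Λ]

/-- Points at bounded distance are mapped to points at bounded distance. -/
def IsControlled (f : Γ → Λ) : Prop :=
  ∀ E : Set Γ, E.Finite → ∃ E' : Set Λ, E'.Finite ∧
    ∀ x y : Γ, x⁻¹ * y ∈ E → (f x)⁻¹ * f y ∈ E'

/-- Points mapped to points at bounded distance are at bounded distance. -/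
def IsCoarselyInjective (f : Γ → Λ) : Prop :=
  ∀ E : Set Λ, E.Finite → ∃ E' : Set Γ, E'.Finite ∧
    ∀ x y : Γ, (f x)⁻¹ * f y ∈ E → x⁻¹ * y ∈ E'

/-- Two maps into a group are close if they differ by right multiplication by elements of a finite
set. -/
def AreClose (f g : X → Λ) : Prop :=
  ∃ E : Set Λ, E.Finite ∧ ∀ x, (f x)⁻¹ * g x ∈ E

lemma AreClose.symm {f g : X → Λ} (h : AreClose f g) : AreClose g f := by
  obtain ⟨E, hE, h⟩ := h
  exact ⟨E⁻¹, hE.inv, fun x => by simpa using h x⟩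

lemma AreClose.trans {f g k : X → Λ} (h : AreClose f g) (h' : AreClose g k) : AreClose f k := by
  obtain ⟨E, hE, h⟩ := h
  obtain ⟨E', hE', h'⟩ := h'
  exact ⟨E * E', hE.mul hE', fun x => ⟨_, h x, _, h' x, by simp [mul_assoc]⟩⟩

lemma AtBoundedDistance.areClose {V : Set Λ} (hV : IsFiniteGeneratingSet V) {f g : X → Λ}
    (h : AtBoundedDistance (SimpleGraph.mulCayley V) f g) : AreClose f g := by
  obtain ⟨K, hK⟩ := h
  refine ⟨unitBall V ^ ⌊K⌋₊, unitBall_pow_finite hV.1 _, fun x => ?_⟩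
  rw [← dist_mulCayley_le_iff hV]
  exact Nat.le_floor (hK x)

lemma IsQuasiIsometry.isControlled {U : Set Γ} {V : Set Λ} (hU : IsFiniteGeneratingSet U)
    (hV : IsFiniteGeneratingSet V) {f : Γ → Λ}
    (h : IsQuasiIsometry (SimpleGraph.mulCayley U) (SimpleGraph.mulCayley V) f) :
    IsControlled f := by
  obtain ⟨C, K, hC, hK, h, -⟩ := h
  intro E hE
  obtain ⟨r, hr⟩ := exists_subset_unitBall_pow hU hE
  refine ⟨unitBall V ^ ⌊C * r + K⌋₊, unitBall_pow_finite hV.1 _, fun x y hxy => ?_⟩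
  rw [← dist_mulCayley_le_iff hV]
  refine Nat.le_floor ((h x y).2.trans ?_)
  have : ((SimpleGraph.mulCayley U).dist x y : ℝ) ≤ r :=
    Nat.cast_le.2 ((dist_mulCayley_le_iff hU).2 (hr hxy))
  gcongr

lemma IsQuasiIsometry.isCoarselyInjective {U : Set Γ} {V : Set Λ} (hU : IsFiniteGeneratingSet U)
    (hV : IsFiniteGeneratingSet V) {f : Γ → Λ}
    (h : IsQuasiIsometry (SimpleGraph.mulCayley U) (SimpleGraph.mulCayley V) f) :
    IsCoarselyInjective f := by
  obtain ⟨C, K, hC, hK, h, -⟩ := h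
  intro E hE
  obtain ⟨r, hr⟩ := exists_subset_unitBall_pow hV hE
  refine ⟨unitBall U ^ ⌊C * (r + K)⌋₊, unitBall_pow_finite hU.1 _, fun x y hxy => ?_⟩
  rw [← dist_mulCayley_le_iff hU]
  have hr' : ((SimpleGraph.mulCayley V).dist (f x) (f y) : ℝ) ≤ r :=
    Nat.cast_le.2 ((dist_mulCayley_le_iff hV).2 (hr hxy))
  have hC0 : 0 < C := by linarith
  have h1 := (h x y).1
  refine Nat.le_floor ?_
  rw [← div_le_iff₀' hC0]
  rw [one_div_mul_eq_div] at h1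
  linarith

/-- A map `g` with `f ∘ g` close to the identity is controlled if `f` is coarsely injective. -/
lemma IsCoarselyInjective.isControlled_of_comp {f : Γ → Λ} {g : Λ → Γ}
    (hf : IsCoarselyInjective f) (hfg : AreClose (f ∘ g) id) : IsControlled g := by
  obtain ⟨D, hD, hfg⟩ := hfg
  intro E hE
  -- The passage from `f (g x)` to `f (g y)` goes through `x` and `y`, whence the three factors.
  obtain ⟨E', hE', h⟩ := hf (D * E * D⁻¹) ((hD.mul hE).mul hD.inv)
  refine ⟨E', hE', fun x y hxy => h _ _ ⟨_, ⟨_, hfg x, _, hxy, rfl⟩, ((f (g y))⁻¹ * y)⁻¹, ?_, ?_⟩⟩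
  · exact Set.inv_mem_inv.2 (hfg y)
  · simp [mul_assoc]

lemma IsCoarselyInjective.finite_preimage {f : Γ → Λ} (hf : IsCoarselyInjective f) {A : Set Λ}
    (hA : A.Finite) : (f ⁻¹' A).Finite := by
  obtain ⟨E, hE, h⟩ := hf (A⁻¹ * A) (hA.inv.mul hA)
  rcases (f ⁻¹' A).eq_empty_or_nonempty with h0 | ⟨x, hx⟩
  · simp [h0]
  · refine ((Set.finite_singleton x).mul hE).subset fun y hy => ?_
    exact ⟨x, rfl, _, h x y ⟨_, Set.inv_mem_inv.2 hx, _, hy, rfl⟩, by simp⟩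

/-- A quasi-isometry is quasi-`m / n`-to-one as soon as it and a quasi-inverse coarsely expand
cardinalities by the factors `n / m` and `m / n`. -/
lemma isQuasiToOne_of_ncard_le {U : Set Γ} {V : Set Λ} (hU : IsFiniteGeneratingSet U)
    (hV : IsFiniteGeneratingSet V) {q : Γ → Λ} {g : Λ → Γ}
    (hq : IsQuasiIsometry (SimpleGraph.mulCayley U) (SimpleGraph.mulCayley V) q)
    (hqg : AreClose (q ∘ g) id) {n m : ℝ} (hn : 0 < n) (hm : 0 < m)
    {E₁ : Set Λ} (hE₁ : E₁.Finite)
    (h₁ : ∀ F : Set Γ, F.Finite → n * F.ncard ≤ m * (q '' F * E₁).ncard)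
    {E₂ : Set Γ} (hE₂ : E₂.Finite)
    (h₂ : ∀ F : Set Λ, F.Finite → m * F.ncard ≤ n * (g '' F * E₂).ncard) :
    IsQuasiToOne (SimpleGraph.mulCayley U) (SimpleGraph.mulCayley V) (m / n) q := by
  refine ⟨hq, div_pos hm hn, ?_⟩
  obtain ⟨E₃, hE₃, h₃⟩ := hq.isControlled hU hV E₂ hE₂
  obtain ⟨E₄, hE₄, h₄⟩ := hqg
  have hE : (E₄⁻¹ * E₃).Finite := hE₄.inv.mul hE₃
  set E : Set Λ := E₄⁻¹ * E₃
  obtain ⟨C₁, hC₁⟩ := exists_ncard_mul_diff_le hV hE₁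
  obtain ⟨C₂, hC₂⟩ := exists_ncard_mul_diff_le hV hE
  -- The summand 1 only makes the constant positive.
  refine ⟨m / n * (C₁ + C₂ * E.ncard + 1), by positivity, fun A hA => ?_⟩
  set b : ℕ := (boundary (SimpleGraph.mulCayley V) A).ncard
  have hfin : (q ⁻¹' A).Finite := (hq.isCoarselyInjective hU hV).finite_preimage hA
  have upper : n * ((q ⁻¹' A).ncard : ℝ) ≤ m * (A.ncard + C₁ * b) := by
    refine (h₁ _ hfin).trans ?_
    gcongr
    have : q '' (q ⁻¹' A) * E₁ ⊆ A ∪ ((A * E₁) \ A) := by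
      rw [Set.union_sdiff_self]
      exact (Set.mul_subset_mul_right (Set.image_preimage_subset q A)).trans
        Set.subset_union_right
    have h := (Set.ncard_le_ncard this (hA.union ((hA.mul hE₁).sdiff))).trans
      (Set.ncard_union_le _ _)
    exact_mod_cast h.trans (Nat.add_le_add_left (hC₁ A hA) _)
  have lower : m * ((A.ncard : ℝ) - C₂ * E.ncard * b) ≤ n * ((q ⁻¹' A).ncard : ℝ) := by
    -- `A'` is the `E`-interior of `A`. Since `q (g a * e)` lies in `a * E` for `e ∈ E₂`, the
    -- thickened image of `A'` under `g` stays in the preimage of `A`.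
    set A' : Set Λ := {a ∈ A | ∀ e ∈ E, a * e ∈ A}
    have hA' : A'.Finite := hA.subset (Set.sep_subset _ _)
    have hsub : g '' A' * E₂ ⊆ q ⁻¹' A := by
      rintro _ ⟨_, ⟨a, ha, rfl⟩, e, he, rfl⟩
      have := ha.2 (((q (g a))⁻¹ * a)⁻¹ * ((q (g a))⁻¹ * q (g a * e)))
        ⟨_, Set.inv_mem_inv.2 (h₄ a), _, h₃ _ _ (by simpa using he), rfl⟩
      simpa [mul_assoc] using this
    have hcard : A.ncard ≤ A'.ncard + C₂ * b * E.ncard := by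
      have : A ⊆ A' ∪ ((A * E) \ A) * E⁻¹ := by
        intro a ha
        by_cases h : a ∈ A'
        · exact Or.inl h
        · have : ∃ e ∈ E, a * e ∉ A := by
            by_contra! h'
            exact h ⟨ha, h'⟩
          obtain ⟨e, he, hae⟩ := this
          exact Or.inr ⟨a * e, ⟨⟨a, ha, e, he, rfl⟩, hae⟩, e⁻¹, Set.inv_mem_inv.2 he, by simp⟩
      refine (Set.ncard_le_ncard this
        (hA'.union (((hA.mul hE).sdiff).mul hE.inv))).trans ((Set.ncard_union_le _ _).trans ?_)
      refine Nat.add_le_add_left ((ncard_mul_le _ _).trans ?_) _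
      rw [Set.ncard_inv]
      exact Nat.mul_le_mul_right _ (hC₂ A hA)
    have hcard' : (A.ncard : ℝ) ≤ A'.ncard + C₂ * b * E.ncard := by exact_mod_cast hcard
    calc m * ((A.ncard : ℝ) - C₂ * E.ncard * b) ≤ m * A'.ncard := by gcongr; linarith
      _ ≤ n * (g '' A' * E₂).ncard := h₂ A' hA'
      _ ≤ n * (q ⁻¹' A).ncard := by
        gcongr
  have e₁ : ((q ⁻¹' A).ncard : ℝ) ≤ m / n * (A.ncard + C₁ * b) := by
    rw [div_mul_eq_mul_div, le_div_iff₀' hn]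
    exact upper
  have e₂ : m / n * ((A.ncard : ℝ) - C₂ * E.ncard * b) ≤ (q ⁻¹' A).ncard := by
    rw [div_mul_eq_mul_div, div_le_iff₀' hn]
    exact lower
  have hk : 0 < m / n := div_pos hm hn
  have p₁ : 0 ≤ m / n * (C₁ * b : ℝ) := by positivity
  have p₂ : 0 ≤ m / n * (C₂ * E.ncard * b : ℝ) := by positivity
  have p₃ : 0 ≤ m / n * (b : ℝ) := by positivity
  rw [abs_le]
  constructor <;> nlinarith

end Controlled

/-! ### Comparison of growth degrees -/

section Growth

variable {N M : Type*} [Group N] [Group M]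

/-- Comparison of growth degrees from a comparison of powers of the growth functions. -/
lemma mul_le_mul_of_growth_pow_le {S : Set N} {T : Set M} {n m : ℝ} (hn : IsGLB (growthExponents S) n)
    (hm : IsGLB (growthExponents T) m) {a b L : ℕ} (ha : 0 < a) (hb : 0 < b) (hL : 0 < L)
    (h : ∀ r : ℕ, growth S r ^ a ≤ growth T (L * r) ^ b) : n * a ≤ m * b := by
  have ha' : (0 : ℝ) < a := Nat.cast_pos.2 ha
  have hb' : (0 : ℝ) < b := Nat.cast_pos.2 hb
  have hL' : (0 : ℝ) < L := Nat.cast_pos.2 hL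
  rw [← div_le_iff₀ hb']
  refine (le_isGLB_iff hm).2 ?_
  rintro d ⟨C, hC⟩
  have hC0 : 0 ≤ C := by
    have := hC 1 le_rfl
    simp only [Nat.cast_one, Real.one_rpow, mul_one] at this
    exact (Nat.cast_nonneg _).trans this
  rw [div_le_iff₀ hb', ← le_div_iff₀ ha']
  -- An exponent `d` for `T` yields the exponent `d * b / a` for `S`; the dilation `L` only enters
  -- the constant.
  refine hn.1 ⟨((C * (L : ℝ) ^ d) ^ b) ^ (1 / a : ℝ), fun r hr => ?_⟩
  have hr' : (0 : ℝ) < r := Nat.cast_pos.2 hr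
  have key : (growth S r : ℝ) ^ a ≤ (C * (L : ℝ) ^ d) ^ b * (r : ℝ) ^ (d * b) := by
    calc (growth S r : ℝ) ^ a ≤ (growth T (L * r) : ℝ) ^ b := by exact_mod_cast h r
      _ ≤ (C * ((L * r : ℕ) : ℝ) ^ d) ^ b := by
        gcongr
        exact hC _ (Nat.mul_pos hL hr)
      _ = (C * (L : ℝ) ^ d) ^ b * (r : ℝ) ^ (d * b) := by
        rw [Nat.cast_mul, Real.mul_rpow hL'.le hr'.le, ← mul_assoc, mul_pow,
          ← Real.rpow_mul_natCast hr'.le]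
  calc (growth S r : ℝ) = ((growth S r : ℝ) ^ a) ^ (1 / a : ℝ) := by
        rw [← Real.rpow_natCast, ← Real.rpow_mul (Nat.cast_nonneg _), mul_one_div_cancel ha'.ne',
          Real.rpow_one]
    _ ≤ ((C * (L : ℝ) ^ d) ^ b * (r : ℝ) ^ (d * b)) ^ (1 / a : ℝ) := by gcongr
    _ = ((C * (L : ℝ) ^ d) ^ b) ^ (1 / a : ℝ) * (r : ℝ) ^ (d * b / a) := by
        rw [Real.mul_rpow (by positivity) (by positivity), ← Real.rpow_mul hr'.le, mul_one_div]

end Growth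

/-! ### Colourings and the effect of changing lamps -/

section Colourings

variable {N G M H : Type*} [Group N] [Group M]

open Classical in
/-- The colouring with value `s` at `p`, trivial elsewhere. -/
noncomputable def lamp (p : G) (s : N) : colourings N G :=
  ⟨Pi.mulSingle p s, (Set.finite_singleton p).subset (Pi.mulSupport_mulSingle_subset)⟩

open Classical in
@[simp]
lemma lamp_apply (p : G) (s : N) (x : G) : (lamp p s).1 x = if x = p then s else 1 := by
  simp [lamp, Pi.mulSingle_apply]

lemma lamp_one (p : G) : lamp p (1 : N) = 1 := by
  ext x
  simp

lemma lamp_mul (p : G) (s t : N) : lamp p (s * t) = lamp p s * lamp p t := by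
  ext x
  by_cases h : x = p <;> simp [h]

lemma colouring_range_finite (c : colourings N G) : (Set.range c.1).Finite := by
  refine ((c.2.image c.1).insert 1).subset ?_
  rintro _ ⟨x, rfl⟩
  by_cases h : c.1 x = 1
  · exact Or.inl h
  · exact Or.inr ⟨x, h, rfl⟩

open Classical in
/-- The extension by `1` of a colouring of a finite set. -/
noncomputable def extendColouring (F : Finset G) (u : F → N) : colourings N G :=
  ⟨fun p => if h : p ∈ F then u ⟨p, h⟩ else 1, F.finite_toSet.subset fun p hp => by
    by_contra h
    exact hp (dif_neg h)⟩

lemma extendColouring_of_mem {F : Finset G} (u : F → N) (p : F) :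
    (extendColouring F u).1 p = u p := by
  simp [extendColouring]

lemma extendColouring_of_notMem {F : Finset G} (u : F → N) {p : G} (hp : p ∉ F) :
    (extendColouring F u).1 p = 1 := by
  simp [extendColouring, hp]

variable [Group H]

lemma inv_mul_left_apply (x y : Wreath M H) (h : H) :
    (x⁻¹ * y).left.1 h = (x.left.1 (x.right * h))⁻¹ * y.left.1 (x.right * h) := by
  simp [shift]

/-- The colourings of the elements of a finite subset of a wreath product have supports in a
common finite set. -/
lemma exists_finite_support {E : Set (Wreath M H)} (hE : E.Finite) :
    ∃ B : Set H, B.Finite ∧ 1 ∈ B ∧ ∀ x y : Wreath M H, x⁻¹ * y ∈ E →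
      ∀ h, h ∉ ({x.right} : Set H) * B → y.left.1 h = x.left.1 h := by
  refine ⟨insert 1 (⋃ e ∈ E, Function.mulSupport e.left.1),
    (hE.biUnion fun e _ => e.left.2).insert 1, Set.mem_insert _ _, fun x y hxy h hh => ?_⟩
  by_contra hne
  refine hh ⟨x.right, rfl, x.right⁻¹ * h, Or.inr (Set.mem_biUnion hxy ?_), by simp⟩
  rw [Function.mem_mulSupport, inv_mul_left_apply]
  simpa [inv_mul_eq_one] using Ne.symm hne

lemma exists_finite_values {E : Set (Wreath M H)} (hE : E.Finite) :
    ∃ R : Set M, R.Finite ∧ ∀ x y : Wreath M H, x⁻¹ * y ∈ E →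
      ∀ h, (x.left.1 h)⁻¹ * y.left.1 h ∈ R := by
  refine ⟨⋃ e ∈ E, Set.range e.left.1, hE.biUnion fun e _ => colouring_range_finite _,
    fun x y hxy h => Set.mem_biUnion hxy ⟨x.right⁻¹ * h, ?_⟩⟩
  rw [inv_mul_left_apply]
  simp

/-- The images of the colourings supported on a finite set differ near the image of this set. -/
lemma colouring_control {α : colourings N G → colourings M H} {β : G → H} {S : Set N} {T : Set M}
    {B : Set H} {L r : ℕ}
    (h : ∀ p : G, ∀ t ∈ unitBall S ^ r, ∀ c h,
      (h ∉ ({β p} : Set H) * B → (α (c * lamp p t)).1 h = (α c).1 h) ∧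
        ((α c).1 h)⁻¹ * (α (c * lamp p t)).1 h ∈ unitBall T ^ (L * r))
    (F : Finset G) (c : colourings N G) (hcF : ∀ p ∉ F, c.1 p = 1)
    (hcr : ∀ p, c.1 p ∈ unitBall S ^ r) (x : H) :
    (x ∉ β '' F * B → (α c).1 x = (α 1).1 x) ∧
      ((α 1).1 x)⁻¹ * (α c).1 x ∈ unitBall T ^ (L * r * F.card) := by
  classical
  induction F using Finset.induction_on generalizing c with
  | empty =>
    obtain rfl : c = 1 := by
      ext p
      exact hcF p (Finset.notMem_empty p)
    simp
  | insert p F hp ih =>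
    -- Switch off the lamp at `p`; switching it back on costs at most `L * r` at each point.
    set c' : colourings N G := c * lamp p (c.1 p)⁻¹ with hc'
    have hc'p : ∀ y, c'.1 y = if y = p then 1 else c.1 y := by
      intro y
      by_cases hy : y = p <;> simp [hc', hy]
    have hc : c = c' * lamp p (c.1 p) := by
      rw [hc', mul_assoc, ← lamp_mul, inv_mul_cancel, lamp_one, mul_one]
    obtain ⟨h1, h2⟩ := ih c' (fun y hy => by
        rw [hc'p]
        split_ifs with h
        · rfl
        · exact hcF y (by simp [h, hy]))
      (fun y => by
        rw [hc'p]
        split_ifs with h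
        · exact one_mem_unitBall_pow S r
        · exact hcr y)
    obtain ⟨h3, h4⟩ := h p (c.1 p) (hcr p) c' x
    rw [← hc] at h3 h4
    refine ⟨fun hx => (h3 fun hx' => hx ?_).trans (h1 fun hx' => hx ?_), ?_⟩
    · exact Set.mul_subset_mul_right (by simp) hx'
    · exact Set.mul_subset_mul_right (Set.image_mono (by simp)) hx'
    · rw [Finset.card_insert_of_notMem hp, mul_add, mul_one, pow_add]
      exact ⟨_, h2, _, h4, by simp [mul_assoc]⟩

/-- An injective map between colourings that locally moves them by a bounded amount gives a
comparison between powers of the growth functions. -/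
lemma growth_pow_le {α : colourings N G → colourings M H} (hα : Function.Injective α)
    {β : G → H} {S : Set N} {T : Set M} (hS : IsFiniteGeneratingSet S)
    (hT : IsFiniteGeneratingSet T) {B : Set H} (hB : B.Finite) {L r : ℕ}
    (h : ∀ p : G, ∀ t ∈ unitBall S ^ r, ∀ c h,
      (h ∉ ({β p} : Set H) * B → (α (c * lamp p t)).1 h = (α c).1 h) ∧
        ((α c).1 h)⁻¹ * (α (c * lamp p t)).1 h ∈ unitBall T ^ (L * r))
    (F : Finset G) :
    growth S r ^ F.card ≤ growth T (L * r * F.card) ^ (β '' F * B).ncard := by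
  have hD : (β '' F * B).Finite := (F.finite_toSet.image β).mul hB
  have := hD.to_subtype
  have := (unitBall_pow_finite hS.1 r).to_subtype
  have := (unitBall_pow_finite hT.1 (L * r * F.card)).to_subtype
  have key : ∀ u : F → ↥(unitBall S ^ r), ∀ x,
      (x ∉ β '' F * B → (α (extendColouring F fun p => (u p : N))).1 x = (α 1).1 x) ∧
      ((α 1).1 x)⁻¹ * (α (extendColouring F fun p => (u p : N))).1 x ∈
        unitBall T ^ (L * r * F.card) := by
    intro u
    refine colouring_control h F _ (fun p hp => extendColouring_of_notMem _ hp) fun p => ?_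
    by_cases hp : p ∈ F
    · rw [extendColouring_of_mem (fun p => (u p : N)) ⟨p, hp⟩]
      exact (u ⟨p, hp⟩).2
    · rw [extendColouring_of_notMem _ hp]
      exact one_mem_unitBall_pow S r
  -- Record the image relative to `α 1`, on the only set where the two can differ.
  let Φ : (F → ↥(unitBall S ^ r)) → (↥(β '' F * B) → ↥(unitBall T ^ (L * r * F.card))) :=
    fun u x => ⟨_, (key u x).2⟩
  have hΦ : Function.Injective Φ := by
    intro u v huv
    have : extendColouring F (fun p => (u p : N)) = extendColouring F fun p => (v p : N) := by
      apply hα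
      ext x
      by_cases hx : x ∈ β '' F * B
      · have := congrArg Subtype.val (congrFun huv ⟨x, hx⟩)
        exact mul_left_cancel this
      · rw [(key u x).1 hx, (key v x).1 hx]
    funext p
    ext
    rw [← extendColouring_of_mem (fun p => (u p : N)) p, this, extendColouring_of_mem]
  have := Nat.card_le_card_of_injective Φ hΦ
  rw [Nat.card_fun, Nat.card_fun] at this
  simpa [growth_eq_ncard hS, growth_eq_ncard hT, Nat.card_coe_set_eq] using this

variable [Group G]

lemma inv_mul_mk_lamp (c : colourings N G) (p : G) (s : N) :
    (⟨c, p⟩ : Wreath N G)⁻¹ * ⟨c * lamp p s, p⟩ = ⟨lamp 1 s, 1⟩ := by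
  ext h
  · rw [inv_mul_left_apply]
    by_cases hh : h = 1 <;> simp [hh]
  · simp

/-- If the colouring changes at one lamp, its image changes by a bounded amount and near the image
of the lamp. -/
lemma exists_lamp_control {q : Wreath N G → Wreath M H} (hq : IsControlled q)
    {α : colourings N G → colourings M H} {β : G → H} (hαβ : ∀ c p, q ⟨c, p⟩ = ⟨α c, β p⟩)
    {S : Set N} {T : Set M} (hS : IsFiniteGeneratingSet S) (hT : IsFiniteGeneratingSet T) :
    ∃ B : Set H, B.Finite ∧ 1 ∈ B ∧ ∃ L : ℕ, 0 < L ∧ ∀ (r : ℕ) (p : G), ∀ t ∈ unitBall S ^ r,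
      ∀ c h, (h ∉ ({β p} : Set H) * B → (α (c * lamp p t)).1 h = (α c).1 h) ∧
        ((α c).1 h)⁻¹ * (α (c * lamp p t)).1 h ∈ unitBall T ^ (L * r) := by
  obtain ⟨E, hE, hqE⟩ := hq ((fun t => (⟨lamp 1 t, 1⟩ : Wreath N G)) '' unitBall S)
    ((unitBall_finite hS.1).image _)
  obtain ⟨B, hB, hB1, hBE⟩ := exists_finite_support hE
  obtain ⟨R, hR, hRE⟩ := exists_finite_values hE
  obtain ⟨L, hL⟩ := exists_subset_unitBall_pow hT hR
  -- Passing to `L + 1` ensures a positive factor.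
  refine ⟨B, hB, hB1, L + 1, Nat.succ_pos L, fun r p => ?_⟩
  have step : ∀ t ∈ unitBall S, ∀ c,
      (⟨α c, β p⟩ : Wreath M H)⁻¹ * ⟨α (c * lamp p t), β p⟩ ∈ E := by
    intro t ht c
    rw [← hαβ, ← hαβ]
    exact hqE _ _ ⟨t, ht, (inv_mul_mk_lamp c p t).symm⟩
  induction r with
  | zero =>
    intro t ht c h
    obtain rfl : t = 1 := by simpa using ht
    simp [lamp_one]
  | succ r ih =>
    intro t ht c h
    rw [pow_succ] at ht
    obtain ⟨s, hs, u, hu, rfl⟩ := ht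
    simp only [lamp_mul, ← mul_assoc]
    obtain ⟨h1, h2⟩ := ih s hs c h
    have h3 := step u hu (c * lamp p s)
    refine ⟨fun hh => (hBE _ _ h3 h hh).trans (h1 hh), ?_⟩
    rw [mul_add, mul_one, pow_add]
    exact ⟨_, h2, _, unitBall_pow_mono T (Nat.le_succ L) (hL (hRE _ _ h3 h)), by simp [mul_assoc]⟩

/-- A controlled map `(c, p) ↦ (α c, β p)` with `α` injective: `β` coarsely expands cardinalities
at least by the quotient of the growth degrees of the lamp groups. -/
lemma exists_ncard_image_base {q : Wreath N G → Wreath M H} (hq : IsControlled q)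
    {α : colourings N G → colourings M H} {β : G → H} (hαβ : ∀ c p, q ⟨c, p⟩ = ⟨α c, β p⟩)
    (hα : Function.Injective α) {n m : ℝ} (hN : HasPolynomialGrowthOfDegree N n)
    (hM : HasPolynomialGrowthOfDegree M m) :
    ∃ B : Set H, B.Finite ∧ ∀ F : Set G, F.Finite → n * F.ncard ≤ m * (β '' F * B).ncard := by
  obtain ⟨S, hS, -, hn⟩ := hN
  obtain ⟨T, hT, -, hm⟩ := hM
  obtain ⟨B, hB, hB1, L, hL, h⟩ := exists_lamp_control hq hαβ hS hT
  refine ⟨B, hB, fun F hF => ?_⟩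
  rcases F.eq_empty_or_nonempty with rfl | hne
  · simp
  lift F to Finset G using hF
  have hne' : F.Nonempty := Finset.coe_nonempty.1 hne
  rw [Set.ncard_coe_finset]
  -- With `F` fixed, `L * F.card` is a constant dilation of the radius, which does not affect the
  -- degree.
  refine mul_le_mul_of_growth_pow_le hn hm hne'.card_pos ?_
    (Nat.mul_pos hL hne'.card_pos) fun r => ?_
  · exact (Set.ncard_pos ((F.finite_toSet.image β).mul hB)).2 ((hne.image β).mul ⟨1, hB1⟩)
  · have := growth_pow_le hα hS hT hB (h r) F
    rwa [mul_right_comm] at this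

end Colourings

/-! ### From the base groups to the wreath products -/

section Aptolic

variable {N G M H : Type*} [Group N] [Group G] [Group M] [Group H]

open Classical in
/-- The expansion of cardinalities passes from the base groups to the wreath products. -/
lemma exists_ncard_image {q : Wreath N G → Wreath M H}
    {α : colourings N G → colourings M H} {β : G → H} (hαβ : ∀ c p, q ⟨c, p⟩ = ⟨α c, β p⟩)
    (hα : Function.Injective α) {n m : ℝ} (hm : 0 ≤ m) {B : Set H} (hB : B.Finite)
    (h : ∀ F : Set G, F.Finite → n * F.ncard ≤ m * (β '' F * B).ncard) :
    ∃ E : Set (Wreath M H), E.Finite ∧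
      ∀ F : Set (Wreath N G), F.Finite → n * F.ncard ≤ m * (q '' F * E).ncard := by
  -- Right multiplication by these elements moves only the base coordinate, so the slice over `c` is
  -- sent into the slice over `α c`.
  refine ⟨SemidirectProduct.inr '' B, hB.image _, fun F hF => ?_⟩
  have hD : (q '' F * SemidirectProduct.inr '' B).Finite := (hF.image q).mul (hB.image _)
  set D : Set (Wreath M H) := q '' F * SemidirectProduct.inr '' B with hD'
  have slice : ∀ c : colourings N G,
      n * ({x ∈ F | x.left = c}.ncard : ℝ) ≤ m * ({y ∈ D | y.left = α c}.ncard : ℝ) := by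
    intro c
    have hinj : Set.InjOn (fun x : Wreath N G => x.right) {x ∈ F | x.left = c} :=
      fun x hx y hy hxy => SemidirectProduct.ext (hx.2.trans hy.2.symm) hxy
    rw [← hinj.ncard_image]
    refine (h _ ((hF.subset (Set.sep_subset _ _)).image _)).trans ?_
    gcongr
    have hinj' : Function.Injective fun k : H => (⟨α c, k⟩ : Wreath M H) :=
      fun x y hxy => congrArg SemidirectProduct.right hxy
    rw [← Set.ncard_image_of_injective _ hinj']
    refine Set.ncard_le_ncard ?_ (hD.subset (Set.sep_subset _ _))
    rintro _ ⟨_, ⟨_, ⟨_, ⟨x, ⟨hx, rfl⟩, rfl⟩, rfl⟩, b, hb, rfl⟩, rfl⟩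
    refine ⟨⟨q x, ⟨x, hx, rfl⟩, SemidirectProduct.inr b, ⟨b, hb, rfl⟩, ?_⟩, rfl⟩
    have hqx : q x = ⟨α x.left, β x.right⟩ := hαβ x.left x.right
    ext1 <;> simp [hqx]
  clear_value D
  lift F to Finset (Wreath N G) using hF
  lift D to Finset (Wreath M H) using hD
  simp only [Finset.mem_coe, ← Finset.coe_filter, Set.ncard_coe_finset] at slice ⊢
  calc n * (F.card : ℝ)
      = ∑ c ∈ F.image (·.left), n * ((F.filter fun x => x.left = c).card : ℝ) := by
        rw [Finset.card_eq_sum_card_image (·.left) F, Nat.cast_sum, Finset.mul_sum]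
    _ ≤ ∑ c ∈ F.image (·.left), m * ((D.filter fun y => y.left = α c).card : ℝ) :=
        Finset.sum_le_sum fun c _ => slice c
    -- Injectivity of `α` ensures that no slice of `D` is counted twice.
    _ = m * ((∑ c ∈ (F.image (·.left)).image α, (D.filter fun y => y.left = c).card : ℕ) : ℝ) := by
        rw [Finset.sum_image hα.injOn, Nat.cast_sum, Finset.mul_sum]
    _ ≤ m * (D.card : ℝ) := by
        rw [Finset.sum_card_fiberwise_eq_card_filter]
        gcongr
        exact Finset.filter_subset _ _

/-- A map `(c, p) ↦ (ρ c, σ p)` close to the identity does not change the colourings. -/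
lemma eq_of_areClose_id [Infinite G] {f : Wreath N G → Wreath N G}
    {ρ : colourings N G → colourings N G} {σ : G → G} (hf : ∀ c p, f ⟨c, p⟩ = ⟨ρ c, σ p⟩)
    (h : AreClose f id) (c : colourings N G) : ρ c = c := by
  obtain ⟨E, hE, h⟩ := h.symm
  obtain ⟨B, hB, -, hBE⟩ := exists_finite_support hE
  ext x
  -- Choose `p` with `x ∉ p * B`: from there the lamp at `x` cannot be altered.
  obtain ⟨p, hp⟩ := ((Set.finite_singleton x).mul hB.inv).infinite_compl.nonempty
  have := hBE _ _ (h ⟨c, p⟩) x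
  rw [hf] at this
  refine this ?_
  rintro ⟨_, rfl, b, hb, hx⟩
  exact hp ⟨x, rfl, b⁻¹, Set.inv_mem_inv.2 hb, by simp [← hx]⟩

end Aptolic

end Lamplighter

/-! ### Proof of the main theorem -/

theorem theoremA {N M G H : Type*} [Group N] [Group M] [Group G] [Group H]
    (n m : ℝ)
    (hN : Lamplighter.HasPolynomialGrowthOfDegree N n)
    (hM : Lamplighter.HasPolynomialGrowthOfDegree M m)
    (hn : 0 < n)
    [Group.FG G] [Group.FG H]
    (hG : Lamplighter.IsAmenableGroup G) (hH : Lamplighter.IsAmenableGroup H)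
    [Infinite G]
    (U : Set (Lamplighter.Wreath N G)) (hU : Lamplighter.IsFiniteGeneratingSet U)
    (V : Set (Lamplighter.Wreath M H)) (hV : Lamplighter.IsFiniteGeneratingSet V)
    (haptolic : ∀ q : Lamplighter.Wreath N G → Lamplighter.Wreath M H,
      Lamplighter.IsQuasiIsometry (SimpleGraph.mulCayley U) (SimpleGraph.mulCayley V) q →
        ∃ q' : Lamplighter.Wreath N G → Lamplighter.Wreath M H,
          Lamplighter.IsAptolic U V q' ∧
            Lamplighter.AtBoundedDistance (SimpleGraph.mulCayley V) q q') :
    ∀ q : Lamplighter.Wreath N G → Lamplighter.Wreath M H,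
      Lamplighter.IsQuasiIsometry (SimpleGraph.mulCayley U) (SimpleGraph.mulCayley V) q →
        Lamplighter.IsQuasiToOne (SimpleGraph.mulCayley U) (SimpleGraph.mulCayley V) (m / n) q := by
  open Lamplighter Pointwise in
  intro q hq
  obtain ⟨q', ⟨hq', ⟨α, β, hαβ⟩, g, ⟨hgq, hqg⟩, α', β', hαβ'⟩, hqq'⟩ := haptolic q hq
  replace hgq := hgq.areClose hU
  replace hqg := hqg.areClose hV
  replace hqq' := hqq'.areClose hV
  have hg : IsControlled g := (hq'.isCoarselyInjective hU hV).isControlled_of_comp hqg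
  have hα : Function.Injective α := Function.LeftInverse.injective (g := α')
    (eq_of_areClose_id (σ := β' ∘ β) (fun c p => by simp [hαβ, hαβ']) hgq)
  obtain ⟨B, hB, hβ⟩ := exists_ncard_image_base (hq'.isControlled hU hV) hαβ hα hN hM
  have hm : 0 < m := by
    by_contra! hm
    have h1 := hβ {1} (Set.finite_singleton 1)
    rw [Set.ncard_singleton, Nat.cast_one, mul_one] at h1
    exact absurd (h1.trans (mul_nonpos_of_nonpos_of_nonneg hm (Nat.cast_nonneg _))) hn.not_ge
  -- For finite `H`, `n |F|` would be at most `m |H|` for all finite `F ⊆ G`. Infinitude of `H` is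
  -- what makes `α'` injective.
  have hH' : Infinite H := by
    by_contra hfin
    rw [not_infinite_iff_finite] at hfin
    obtain ⟨k, hk⟩ := exists_nat_gt (m * Nat.card H / n)
    obtain ⟨F, hF, hFk⟩ := (Set.infinite_univ (α := G)).exists_subset_ncard_eq k
    rw [div_lt_iff₀' hn] at hk
    by_cases hFf : F.Finite
    · have h1 := hβ F hFf
      have h2 : (β '' F * B).ncard ≤ Nat.card H := Set.ncard_le_card _
      have h3 : m * ((β '' F * B).ncard : ℝ) ≤ m * Nat.card H := by gcongr
      rw [hFk.2] at h1
      linarith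
    · exact hFf hFk.1
  have hα' : Function.Injective α' := Function.LeftInverse.injective (g := α)
    (eq_of_areClose_id (σ := β ∘ β') (fun c p => by simp [hαβ, hαβ']) hqg)
  obtain ⟨B', hB', hβ'⟩ := exists_ncard_image_base hg hαβ' hα' hM hN
  obtain ⟨E₁, hE₁, h₁⟩ := exists_ncard_image hαβ hα hm.le hB hβ
  obtain ⟨E₂, hE₂, h₂⟩ := exists_ncard_image hαβ' hα' hn.le hB' hβ'
  -- The inequality for `q'` passes to `q` by enlarging `E₁` to `D * E₁`, and `g` remains a coarse
  -- right inverse of `q`.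
  obtain ⟨D, hD, hqD⟩ := id hqq'
  refine isQuasiToOne_of_ncard_le hU hV hq (g := g) (AreClose.trans ?_ hqg) hn hm (hD.mul hE₁)
    (fun F hF => (h₁ F hF).trans ?_) hE₂ h₂
  · exact ⟨D, hD, fun x => hqD (g x)⟩
  · refine mul_le_mul_of_nonneg_left (Nat.cast_le.2 ?_) hm.le
    refine Set.ncard_le_ncard ?_ ((hF.image q).mul (hD.mul hE₁))
    rw [← mul_assoc]
    refine Set.mul_subset_mul_right ?_
    rintro _ ⟨x, hx, rfl⟩
    exact ⟨q x, ⟨x, hx, rfl⟩, _, hqD x, by simp⟩
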